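/- For real $\alpha>-1$ and $x>0$ let $$I_\alpha(x)=\sum_{k=0}^{\infty}\frac{(x/2)^{2k+\alpha}}{k!\,\Gamma(k+\alpha+1)}$$ be the modified Bessel function of the first kind. Let $\mu>-1$, $q>-1$ and $0<\gamma<1$ be real, and for $x>0$ put $$R_{\mu,q,\gamma}(x)=\frac{\int_0^x e^{-\gamma t}\,t^{q-\mu}I_\mu(t)\,dt}{e^{-\gamma x}\,x^{q-\mu}I_{\mu+1}(x)},\qquad M^*_{\mu,q,\gamma}=\sup_{x>0}R_{\mu,q,\gamma}(x).$$ The integrals converge, and the following hold. (i) As $x\downarrow0$, $$R_{\mu,q,\gamma}(x)=\frac{2(\mu+1)}{q+1}\left[1+\frac{\gamma x}{q+2}+\left\{\frac{\gamma^2}{(q+2)(q+3)}+\frac{q+1}{4(\mu+1)(q+3)}-\frac{1}{4(\mu+2)}\right\}x^2+O(x^3)\right].$$ (ii) As $x\to\infty$, $$R_{\mu,q,\gamma}(x)=\frac1{1-\gamma}+\frac{(\mu+1/2)(2-\gamma)-q}{(1-\gamma)^2x}+O(x^{-2}).$$ (iii) $M^*_{\mu,q,\gamma}$ is finite and $M^*_{\mu,q,\gamma}>\dfrac{2(\mu+1)}{q+1}$.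 If moreover $q<(\mu+1/2)(2-\gamma)$, then also $M^*_{\mu,q,\gamma}>\dfrac1{1-\gamma}$. The constants implied in the $O$-terms may depend on $\mu,q,\gamma$. -/

import Mathlib

open Filter Topology Asymptotics

noncomputable section

/-- The modified Bessel function of the first kind `I_α(x)` of real order `α`, for `x > 0`, by its
power series `∑ₖ (x/2)^(2k+α) / (k! Γ(k+α+1))`. (At a pole of `Γ` the term is `0`, in agreement
with the usual convention `1/Γ = 0` there.) -/
def besselI (α x : ℝ) : ℝ :=
  ∑' k : ℕ, (x / 2) ^ (2 * (k : ℝ) + α) / ((k.factorial : ℝ) * Real.Gamma ((k : ℝ) + α + 1))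

/-- The integrand `exp(-γ t) t^(q-μ) I_μ(t)`. -/
def quotientIntegrand (μ q γ t : ℝ) : ℝ :=
  Real.exp (-(γ * t)) * t ^ (q - μ) * besselI μ t

/-- The quotient `R_{μ,q,γ}(x)`, for `x > 0`. -/
def sharpQuotient (μ q γ x : ℝ) : ℝ :=
  (∫ t in (0 : ℝ)..x, quotientIntegrand μ q γ t) /
    (Real.exp (-(γ * x)) * x ^ (q - μ) * besselI (μ + 1) x)

/-- The sharp constant `M*_{μ,q,γ} = sup_{x>0} R_{μ,q,γ}(x)`. -/
def sharpConstant (μ q γ : ℝ) : ℝ :=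
  sSup (sharpQuotient μ q γ '' Set.Ioi 0)

end

/-! Both expansions avoid explicit asymptotics of the Bessel functions. At the origin, all
noninteger powers cancel and R becomes a quotient of functions with Taylor expansions
(`sharpQuotient_eq`); integrating against `t^q` and clearing the denominator gives (i).

At infinity, R solves R' = k - (-γ + (q-2μ-1)/x + k) R with k = I_μ/I_{μ+1}
(`hasDerivAt_sharpQuotient`). Since k → 1, the damping tends to 1-γ > 0, and a damped linear
equation passes the decay rate of its forcing on to its solution
(`isBigO_inv_pow_of_hasDerivAt_damped`). The same principle, applied to the Riccati equation of
I_{μ+1}/I_μ, expands k. Applied to R minus its formal two-term solution, it gives (ii).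

For (iii), R is continuous with finite limits at both ends, hence bounded above; a positive
first-order coefficient at an end makes R exceed its limit there. -/

/-! ### The entire part of the Bessel function. -/

/-- The coefficients `1 / (k! Γ(k+α+1))` of the entire part of the modified Bessel function. -/
noncomputable def besselCoeff (α : ℝ) (k : ℕ) : ℝ :=
  1 / ((k.factorial : ℝ) * Real.Gamma ((k : ℝ) + α + 1))

/-- The entire part `E_α(z) = ∑ₖ z^k / (k! Γ(k+α+1))` of the modified Bessel function, so that
`I_α(x) = (x/2)^α E_α(x²/4)`. -/
noncomputable def besselEntire (α z : ℝ) : ℝ :=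
  ∑' k : ℕ, besselCoeff α k * z ^ k

theorem besselCoeff_pos {α : ℝ} (hα : -1 < α) (k : ℕ) : 0 < besselCoeff α k := by
  have hk : (0 : ℝ) ≤ k := k.cast_nonneg
  have := Real.Gamma_pos_of_pos (show 0 < (k : ℝ) + α + 1 by linarith)
  unfold besselCoeff
  positivity

/-- Term-by-term form of `E_α' = E_{α+1}`. -/
theorem succ_mul_besselCoeff_succ (α : ℝ) (k : ℕ) :
    ((k : ℝ) + 1) * besselCoeff α (k + 1) = besselCoeff (α + 1) k := by
  have hk : (k : ℝ) + 1 ≠ 0 := by positivity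
  unfold besselCoeff
  rw [Nat.factorial_succ]
  push_cast
  rw [show (k : ℝ) + 1 + α + 1 = k + (α + 1) + 1 by ring, mul_assoc, ← mul_div_assoc, mul_one]
  exact div_mul_cancel_left₀ hk _ |>.trans (one_div _).symm

theorem besselCoeff_eq_mul {α : ℝ} (hα : -1 < α) (k : ℕ) :
    besselCoeff α k = ((k : ℝ) + α + 1) * besselCoeff (α + 1) k := by
  have hk : (0 : ℝ) ≤ k := k.cast_nonneg
  have h : (0 : ℝ) < (k : ℝ) + α + 1 := by linarith
  have := (Real.Gamma_pos_of_pos h).ne'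
  unfold besselCoeff
  rw [show (k : ℝ) + (α + 1) + 1 = (k + α + 1) + 1 by ring, Real.Gamma_add_one h.ne']
  field_simp

theorem besselCoeff_succ {α : ℝ} (hα : -1 < α) (k : ℕ) :
    besselCoeff α (k + 1) = besselCoeff α k / (((k : ℝ) + 1) * ((k : ℝ) + α + 1)) := by
  have hk : (0 : ℝ) ≤ k := k.cast_nonneg
  have h : (0 : ℝ) < (k : ℝ) + α + 1 := by linarith
  rw [besselCoeff_eq_mul hα k, ← succ_mul_besselCoeff_succ]
  field_simp

theorem summable_besselCoeff {α : ℝ} (hα : -1 < α) (z : ℝ) :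
    Summable fun k : ℕ => besselCoeff α k * z ^ k := by
  rcases eq_or_ne z 0 with rfl | hz
  · refine summable_of_ne_finset_zero (s := {0}) fun k hk => ?_
    rw [zero_pow (by simpa using hk), mul_zero]
  refine summable_of_ratio_test_tendsto_lt_one (l := 0) one_pos
    (Eventually.of_forall fun k => mul_ne_zero (besselCoeff_pos hα k).ne' (pow_ne_zero _ hz)) ?_
  have key : ∀ k : ℕ, ‖besselCoeff α (k + 1) * z ^ (k + 1)‖ / ‖besselCoeff α k * z ^ k‖
      = |z| / (((k : ℝ) + 1) * ((k : ℝ) + α + 1)) := by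
    intro k
    have hk : (0 : ℝ) ≤ k := k.cast_nonneg
    have h : (0 : ℝ) < (k : ℝ) + α + 1 := by linarith
    have h0 := besselCoeff_pos hα k
    have hz' := abs_pos.mpr hz
    rw [besselCoeff_succ hα, norm_mul, norm_mul, norm_pow, norm_pow, Real.norm_eq_abs,
      Real.norm_eq_abs, Real.norm_eq_abs, abs_of_pos h0, abs_of_pos (by positivity), pow_succ]
    field_simp
  simp_rw [key]
  refine tendsto_const_nhds.div_atTop (Tendsto.atTop_mul_atTop₀ ?_ ?_)
  · exact tendsto_atTop_add_const_right _ _ tendsto_natCast_atTop_atTop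
  · exact tendsto_atTop_add_const_right _ _
      (tendsto_atTop_add_const_right _ _ tendsto_natCast_atTop_atTop)

theorem besselEntire_pos {α : ℝ} (hα : -1 < α) {z : ℝ} (hz : 0 ≤ z) : 0 < besselEntire α z := by
  refine (summable_besselCoeff hα z).tsum_pos
    (fun k => mul_nonneg (besselCoeff_pos hα k).le (pow_nonneg hz k)) 0 ?_
  simpa using besselCoeff_pos hα 0

theorem hasDerivAt_besselEntire {α : ℝ} (hα : -1 < α) (z : ℝ) :
    HasDerivAt (besselEntire α) (besselEntire (α + 1) z) z := by
  -- On the ball of radius `r` the differentiated series is dominated by its values at `r`.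
  set r : ℝ := |z| + 1
  have hr : 0 ≤ r := by positivity
  have hα' : -1 < α + 1 := by linarith
  -- The term at 0 vanishes; after the index shift the truncated exponent `k - 1` is harmless.
  have hshift : ∀ w : ℝ, ∀ k : ℕ, besselCoeff α (k + 1) * (((k + 1 : ℕ) : ℝ) * w ^ (k + 1 - 1))
      = besselCoeff (α + 1) k * w ^ k := by
    intro w k
    rw [← succ_mul_besselCoeff_succ]
    rw [Nat.add_sub_cancel]
    push_cast
    ring
  have hsum : Summable fun k : ℕ => besselCoeff α k * ((k : ℝ) * r ^ (k - 1)) := by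
    rw [← summable_nat_add_iff 1]
    simpa only [hshift] using summable_besselCoeff hα' r
  have hz : z ∈ Metric.ball (0 : ℝ) r := by simp [r]
  have h := hasDerivAt_tsum_of_isPreconnected (𝕜 := ℝ) (F := ℝ)
    (g := fun k w => besselCoeff α k * w ^ k)
    (g' := fun k w => besselCoeff α k * ((k : ℝ) * w ^ (k - 1))) (y := z) (y₀ := z) hsum
    Metric.isOpen_ball (convex_ball (0 : ℝ) r).isPreconnected
    (fun k w _ => (hasDerivAt_pow k w).const_mul _)
    (fun k w hw => ?_) hz (summable_besselCoeff hα z) hz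
  · have hs : Summable fun k : ℕ => besselCoeff α k * ((k : ℝ) * z ^ (k - 1)) := by
      rw [← summable_nat_add_iff 1]
      simpa only [hshift] using summable_besselCoeff hα' z
    refine h.congr_deriv ?_
    rw [hs.tsum_eq_zero_add]
    simp only [hshift]
    simp [besselEntire]
  · have hw' : |w| ≤ r := by simpa using (Metric.mem_ball.mp hw).le
    have h0 := besselCoeff_pos hα k
    rw [norm_mul, norm_mul, norm_pow, Real.norm_eq_abs, Real.norm_eq_abs, Real.norm_eq_abs,
      abs_of_pos h0, Nat.abs_cast]
    gcongr

theorem continuous_besselEntire {α : ℝ} (hα : -1 < α) : Continuous (besselEntire α) :=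
  continuous_iff_continuousAt.mpr fun z => (hasDerivAt_besselEntire hα z).continuousAt

/-- Split the factor k + α + 1 of `besselCoeff_eq_mul`: the part k produces z times the derivative
of E_{α+1}. -/
theorem besselEntire_recurrence {α : ℝ} (hα : -1 < α) (z : ℝ) :
    besselEntire α z = (α + 1) * besselEntire (α + 1) z + z * besselEntire (α + 2) z := by
  have h1 : -1 < α + 1 := by linarith
  have h2 : -1 < α + 2 := by linarith
  have hs := (summable_besselCoeff h1 z).mul_left (α + 1)
  have hshift : ∀ k : ℕ, ((k + 1 : ℕ) : ℝ) * besselCoeff (α + 1) (k + 1) * z ^ (k + 1)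
      = z * (besselCoeff (α + 2) k * z ^ k) := by
    intro k
    have := succ_mul_besselCoeff_succ (α + 1) k
    rw [show α + 1 + 1 = α + 2 by ring] at this
    rw [← this]
    push_cast
    ring
  have hs' : Summable fun k : ℕ => (k : ℝ) * besselCoeff (α + 1) k * z ^ k := by
    rw [← summable_nat_add_iff 1]
    simpa only [hshift] using (summable_besselCoeff h2 z).mul_left z
  have : besselEntire α z = ∑' k : ℕ, ((α + 1) * (besselCoeff (α + 1) k * z ^ k)
      + (k : ℝ) * besselCoeff (α + 1) k * z ^ k) := by
    refine tsum_congr fun k => ?_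
    rw [besselCoeff_eq_mul hα]
    ring
  rw [this, hs.tsum_add hs', hs'.tsum_eq_zero_add]
  simp only [hshift, tsum_mul_left]
  simp [besselEntire]

/-- First-order Taylor expansion of `E_α` at the origin. -/
theorem besselEntire_sub_isBigO {α : ℝ} (hα : -1 < α) :
    (fun z => besselEntire α z - besselCoeff α 0 * (1 + z / (α + 1)))
      =O[𝓝[≥] (0 : ℝ)] fun z => z ^ 2 := by
  have hα' : α + 1 ≠ 0 := by linarith
  have hS : Summable fun k : ℕ => besselCoeff α (k + 2) := by
    simpa using (summable_nat_add_iff 2).mpr (summable_besselCoeff hα 1)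
  refine IsBigO.of_bound (∑' k : ℕ, besselCoeff α (k + 2)) ?_
  filter_upwards [Icc_mem_nhdsGE (zero_lt_one' ℝ)] with z hz
  have hz0 := hz.1
  have hsplit := (summable_besselCoeff hα z).sum_add_tsum_nat_add 2
  have htail : ∀ k : ℕ, besselCoeff α (k + 2) * z ^ (k + 2)
      = z ^ 2 * (besselCoeff α (k + 2) * z ^ k) := fun k => by ring
  simp only [htail, tsum_mul_left, Finset.sum_range_succ, Finset.sum_range_zero] at hsplit
  have hle : ∀ k : ℕ, besselCoeff α (k + 2) * z ^ k ≤ besselCoeff α (k + 2) := fun k =>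
    mul_le_of_le_one_right (besselCoeff_pos hα _).le (pow_le_one₀ hz0 hz.2)
  have hnn : ∀ k : ℕ, 0 ≤ besselCoeff α (k + 2) * z ^ k := fun k =>
    mul_nonneg (besselCoeff_pos hα _).le (pow_nonneg hz0 _)
  have hsz : Summable fun k : ℕ => besselCoeff α (k + 2) * z ^ k :=
    Summable.of_nonneg_of_le hnn hle hS
  have h1 := hsz.tsum_le_tsum hle hS
  have h0 : 0 ≤ ∑' k : ℕ, besselCoeff α (k + 2) * z ^ k := tsum_nonneg hnn
  have hc : besselCoeff α 1 = besselCoeff α 0 / (α + 1) := by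
    simpa using besselCoeff_succ hα 0
  have : besselEntire α z - besselCoeff α 0 * (1 + z / (α + 1))
      = z ^ 2 * ∑' k : ℕ, besselCoeff α (k + 2) * z ^ k := by
    rw [besselEntire, ← hsplit]
    simp only [zero_add, hc]
    field_simp
    ring
  rw [this, norm_mul, Real.norm_of_nonneg h0, mul_comm]
  gcongr

/-! ### Recurrence and derivatives of I_α. -/

theorem besselI_eq {α x : ℝ} (hx : 0 < x) :
    besselI α x = (x / 2) ^ α * besselEntire α (x ^ 2 / 4) := by
  rw [besselI, besselEntire, ← tsum_mul_left]
  refine tsum_congr fun k => ?_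
  rw [Real.rpow_add (by positivity), show (2 * (k : ℝ)) = ((2 * k : ℕ) : ℝ) by push_cast; ring,
    Real.rpow_natCast, pow_mul, besselCoeff, show (x / 2) ^ 2 = x ^ 2 / 4 by ring]
  ring

theorem besselI_pos {α x : ℝ} (hα : -1 < α) (hx : 0 < x) : 0 < besselI α x := by
  rw [besselI_eq hx]
  have := besselEntire_pos hα (z := x ^ 2 / 4) (by positivity)
  positivity

theorem besselI_recurrence {α x : ℝ} (hα : -1 < α) (hx : 0 < x) :
    besselI α x = 2 * (α + 1) / x * besselI (α + 1) x + besselI (α + 2) x := by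
  have h2 : (0 : ℝ) < x / 2 := by positivity
  rw [besselI_eq hx, besselI_eq hx, besselI_eq hx, besselEntire_recurrence hα, Real.rpow_add h2,
    Real.rpow_add h2, Real.rpow_one, Real.rpow_two]
  field_simp
  ring

theorem hasDerivAt_besselI {α x : ℝ} (hα : -1 < α) (hx : 0 < x) :
    HasDerivAt (besselI α) (α / x * besselI α x + besselI (α + 1) x) x := by
  have h2 : (0 : ℝ) < x / 2 := by positivity
  have hE : HasDerivAt (fun y : ℝ => besselEntire α (y ^ 2 / 4))
      (besselEntire (α + 1) (x ^ 2 / 4) * (x / 2)) x := by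
    refine HasDerivAt.comp (h := fun y : ℝ => y ^ 2 / 4) x (hasDerivAt_besselEntire hα (x ^ 2 / 4)) ?_
    convert (hasDerivAt_pow 2 x).div_const 4 using 1
    norm_num
    ring
  have hp : HasDerivAt (fun y : ℝ => (y / 2) ^ α) (1 / 2 * α * (x / 2) ^ (α - 1)) x :=
    ((hasDerivAt_id x).div_const 2).rpow_const (Or.inl h2.ne')
  refine ((hp.mul hE).congr_of_eventuallyEq ?_).congr_deriv ?_
  · filter_upwards [eventually_gt_nhds hx] with y hy using besselI_eq hy
  · rw [besselI_eq hx, besselI_eq hx, Real.rpow_add h2, Real.rpow_one, Real.rpow_sub_one h2.ne']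
    field_simp

/-- Eliminating I_{α+2} by the recurrence closes the pair (I_α, I_{α+1}) under differentiation. -/
theorem hasDerivAt_besselI_succ {α x : ℝ} (hα : -1 < α) (hx : 0 < x) :
    HasDerivAt (besselI (α + 1)) (besselI α x - (α + 1) / x * besselI (α + 1) x) x := by
  refine (hasDerivAt_besselI (by linarith) hx).congr_deriv ?_
  rw [besselI_recurrence hα hx, show α + 1 + 1 = α + 2 by ring]
  ring

/-! ### Damped linear equations at infinity. -/

/-- Barrier argument: at the level |z x₀| + C/a + 1 the derivative is at most -a < 0, so `z` cannot
cross it. The summand 1 makes this strict. -/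
theorem le_of_hasDerivAt_of_damped {z A B : ℝ → ℝ} {x₀ a C : ℝ} (ha : 0 < a)
    (hz : ∀ x ≥ x₀, HasDerivAt z (-A x * z x + B x) x) (hA : ∀ x ≥ x₀, a ≤ A x)
    (hB : ∀ x ≥ x₀, |B x| ≤ C) {x : ℝ} (hx : x₀ ≤ x) :
    z x ≤ |z x₀| + C / a + 1 := by
  have hC : 0 ≤ C := (abs_nonneg _).trans (hB x₀ le_rfl)
  have hK : 0 < |z x₀| + C / a + 1 := by positivity
  refine image_le_of_deriv_right_lt_deriv_boundary (f := z) (a := x₀) (b := x)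
    (B := fun _ => |z x₀| + C / a + 1) (B' := fun _ => 0)
    (fun y hy => (hz y hy.1).continuousAt.continuousWithinAt)
    (fun y hy => (hz y hy.1).hasDerivWithinAt) ?_ (fun y => hasDerivAt_const _ _) ?_
    (Set.right_mem_Icc.mpr hx)
  · have := le_abs_self (z x₀)
    have : 0 ≤ C / a := by positivity
    linarith
  · intro y hy hzy
    have h1 : a * (|z x₀| + C / a + 1) ≤ A y * z y := by
      rw [hzy]
      gcongr
      exact hA y hy.1
    have h2 := (le_abs_self _).trans (hB y hy.1)
    have h3 : a * (|z x₀| + C / a + 1) = a * |z x₀| + C + a := by field_simp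
    have h4 : 0 ≤ a * |z x₀| := by positivity
    linarith

/-- Solutions of the damped linear equation `z' = -A z + B` with `A` eventually bounded below by a
positive constant and `B` bounded are bounded. -/
theorem isBigO_one_of_hasDerivAt_damped {z A B : ℝ → ℝ} {a : ℝ} (ha : 0 < a)
    (hz : ∀ᶠ x in atTop, HasDerivAt z (-A x * z x + B x) x) (hA : ∀ᶠ x in atTop, a ≤ A x)
    (hB : B =O[atTop] fun _ => (1 : ℝ)) : z =O[atTop] fun _ => (1 : ℝ) := by
  obtain ⟨C, hC⟩ := hB.bound
  obtain ⟨x₀, h₀⟩ := eventually_atTop.mp (hz.and (hA.and hC))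
  refine IsBigO.of_bound (|z x₀| + C / a + 1) ?_
  filter_upwards [eventually_ge_atTop x₀] with x hx
  have h1 := le_of_hasDerivAt_of_damped ha (fun y hy => (h₀ y hy).1) (fun y hy => (h₀ y hy).2.1)
    (fun y hy => by simpa using (h₀ y hy).2.2) hx
  have h2 := le_of_hasDerivAt_of_damped (z := fun y => -z y) (B := fun y => -B y) ha
    (fun y hy => ((h₀ y hy).1.neg).congr_deriv (by ring)) (fun y hy => (h₀ y hy).2.1)
    (fun y hy => by simpa using (h₀ y hy).2.2) hx
  rw [abs_neg] at h2
  simp only [norm_one, mul_one, Real.norm_eq_abs]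
  exact abs_le.mpr ⟨by linarith, h1⟩

/-- Multiplying by x^n changes the damping to A - n/x, which is eventually at least a/2, and makes
the forcing bounded. -/
theorem isBigO_inv_pow_of_hasDerivAt_damped {y A B : ℝ → ℝ} {a : ℝ} (n : ℕ) (ha : 0 < a)
    (hy : ∀ᶠ x in atTop, HasDerivAt y (-A x * y x + B x) x) (hA : ∀ᶠ x in atTop, a ≤ A x)
    (hB : B =O[atTop] fun x => 1 / x ^ n) : y =O[atTop] fun x => 1 / x ^ n := by
  have hsmall : ∀ᶠ x : ℝ in atTop, (n : ℝ) / x ≤ a / 2 :=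
    (tendsto_const_nhds.div_atTop tendsto_id).eventually (ge_mem_nhds (by positivity))
  have key : (fun x => x ^ n * y x) =O[atTop] fun _ => (1 : ℝ) := by
    refine isBigO_one_of_hasDerivAt_damped (A := fun x => A x - n / x)
      (B := fun x => x ^ n * B x) (half_pos ha) ?_ ?_ ?_
    · filter_upwards [hy, eventually_gt_atTop 0] with x hx hx0
      refine ((hasDerivAt_pow n x).mul hx).congr_deriv ?_
      rcases n with _ | n
      · simp
      · rw [Nat.add_sub_cancel]
        field_simp
        ring
    · filter_upwards [hA, hsmall] with x h1 h2
      linarith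
    · refine ((isBigO_refl (fun x : ℝ => x ^ n) atTop).mul hB).trans_eventuallyEq ?_
      filter_upwards [eventually_gt_atTop 0] with x hx
      field_simp
  refine IsBigO.congr' ((isBigO_refl (fun x : ℝ => 1 / x ^ n) atTop).mul key) ?_ ?_
  · filter_upwards [eventually_gt_atTop 0] with x hx
    field_simp
  · exact Eventually.of_forall fun x => mul_one _

/-! ### Asymptotics of I_{α+1}/I_α. -/

/-- The ratio `I_{α+1}/I_α` satisfies a Riccati equation. -/
theorem hasDerivAt_besselI_ratio {α x : ℝ} (hα : -1 < α) (hx : 0 < x) :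
    HasDerivAt (fun y => besselI (α + 1) y / besselI α y)
      (1 - (besselI (α + 1) x / besselI α x) ^ 2
        - (2 * α + 1) / x * (besselI (α + 1) x / besselI α x)) x := by
  have h0 := (besselI_pos hα hx).ne'
  refine ((hasDerivAt_besselI_succ hα hx).div (hasDerivAt_besselI hα hx) h0).congr_deriv ?_
  field_simp
  ring

/-- Factoring h² - 1 turns the Riccati equation into a linear one for h - 1 whose damping contains h
itself; h > 0 keeps it above 1/2. -/
theorem besselI_ratio_sub_one_isBigO {α : ℝ} (hα : -1 < α) :
    (fun x => besselI (α + 1) x / besselI α x - 1) =O[atTop] fun x => 1 / x ^ 1 := by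
  set h : ℝ → ℝ := fun x => besselI (α + 1) x / besselI α x with hdef
  refine isBigO_inv_pow_of_hasDerivAt_damped (A := fun x => h x + 1 + (2 * α + 1) / x)
    (B := fun x => -((2 * α + 1) / x)) (a := 1 / 2) 1 (by norm_num) ?_ ?_ ?_
  · filter_upwards [eventually_gt_atTop 0] with x hx
    refine ((hasDerivAt_besselI_ratio hα hx).sub_const 1).congr_deriv ?_
    simp only [hdef]
    ring
  · have : ∀ᶠ x : ℝ in atTop, -(1 / 2) ≤ (2 * α + 1) / x :=
      (tendsto_const_nhds.div_atTop tendsto_id).eventually (le_mem_nhds (by norm_num))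
    filter_upwards [this, eventually_gt_atTop 0] with x hx hx0
    have : 0 < h x := div_pos (besselI_pos (by linarith) hx0) (besselI_pos hα hx0)
    linarith
  · refine ((isBigO_refl (fun x : ℝ => 1 / x ^ 1) atTop).const_mul_left (-(2 * α + 1))).congr_left ?_
    intro x
    ring

/-- Bootstrap with the same damping: the constant α + 1/2 cancels the 1/x part of the forcing, and
the previous bound makes (h - 1)/x of order 1/x². -/
theorem besselI_ratio_sub_isBigO {α : ℝ} (hα : -1 < α) :
    (fun x => besselI (α + 1) x / besselI α x - (1 - (α + 1 / 2) / x))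
      =O[atTop] fun x => 1 / x ^ 2 := by
  have hone := besselI_ratio_sub_one_isBigO hα
  set h : ℝ → ℝ := fun x => besselI (α + 1) x / besselI α x with hdef
  refine isBigO_inv_pow_of_hasDerivAt_damped (A := fun x => h x + 1 + (2 * α + 1) / x)
    (B := fun x => (α + 1 / 2) * ((1 / x ^ 1) * (h x - 1))
      + ((α + 1 / 2) * (2 * α) * (1 / x ^ 2))) (a := 1 / 2) 2 (by norm_num) ?_ ?_ ?_
  · filter_upwards [eventually_gt_atTop 0] with x hx
    have hd := ((hasDerivAt_inv hx.ne').const_mul (α + 1 / 2)).const_sub 1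
    refine ((hasDerivAt_besselI_ratio hα hx).sub hd).congr_deriv ?_
    simp only [hdef]
    field_simp
    ring
  · have : ∀ᶠ x : ℝ in atTop, -(1 / 2) ≤ (2 * α + 1) / x :=
      (tendsto_const_nhds.div_atTop tendsto_id).eventually (le_mem_nhds (by norm_num))
    filter_upwards [this, eventually_gt_atTop 0] with x hx hx0
    have : 0 < h x := div_pos (besselI_pos (by linarith) hx0) (besselI_pos hα hx0)
    linarith
  · refine IsBigO.add ?_ ((isBigO_refl _ _).const_mul_left _)
    refine (((isBigO_refl (fun x : ℝ => 1 / x ^ 1) atTop).mul hone).const_mul_left _).congr_right ?_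
    intro x
    ring

/-! ### The integral and the differential equation for R. -/

/-- The smooth factor `e^{-γt} E_α(t²/4)` of the integrand. -/
noncomputable def besselWeight (α γ t : ℝ) : ℝ :=
  Real.exp (-(γ * t)) * besselEntire α (t ^ 2 / 4)

theorem continuous_besselWeight {α : ℝ} (hα : -1 < α) (γ : ℝ) : Continuous (besselWeight α γ) := by
  have := continuous_besselEntire hα
  unfold besselWeight
  fun_prop

theorem besselWeight_pos {α : ℝ} (hα : -1 < α) (γ t : ℝ) : 0 < besselWeight α γ t :=
  mul_pos (Real.exp_pos _) (besselEntire_pos hα (by positivity))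

theorem quotientIntegrand_eq {μ q γ t : ℝ} (ht : 0 < t) :
    quotientIntegrand μ q γ t = (1 / 2) ^ μ * (t ^ q * besselWeight μ γ t) := by
  rw [quotientIntegrand, besselI_eq ht, besselWeight, Real.rpow_sub ht, div_eq_mul_one_div t 2,
    Real.mul_rpow ht.le (by norm_num)]
  have := (Real.rpow_pos_of_pos ht μ).ne'
  field_simp

theorem intervalIntegrable_rpow_mul_of_continuous {q : ℝ} (hq : -1 < q) {φ : ℝ → ℝ}
    (hφ : Continuous φ) (a b : ℝ) :
    IntervalIntegrable (fun t => t ^ q * φ t) MeasureTheory.volume a b :=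
  (intervalIntegral.intervalIntegrable_rpow' hq).mul_continuousOn hφ.continuousOn

theorem intervalIntegrable_quotientIntegrand {μ q γ x : ℝ} (hμ : -1 < μ) (hq : -1 < q)
    (hx : 0 < x) : IntervalIntegrable (quotientIntegrand μ q γ) MeasureTheory.volume 0 x := by
  refine ((intervalIntegrable_rpow_mul_of_continuous hq (continuous_besselWeight hμ γ) 0 x).const_mul
    ((1 / 2) ^ μ)).congr ?_
  intro t ht
  -- The rewriting of the integrand requires t > 0; the half-open interval omits 0.
  rw [Set.uIoc_of_le hx.le] at ht
  exact (quotientIntegrand_eq ht.1).symm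

theorem integral_quotientIntegrand {μ q γ x : ℝ} (hx : 0 < x) :
    ∫ t in (0 : ℝ)..x, quotientIntegrand μ q γ t =
      (1 / 2) ^ μ * ∫ t in (0 : ℝ)..x, t ^ q * besselWeight μ γ t := by
  rw [← intervalIntegral.integral_const_mul]
  refine intervalIntegral.integral_congr_ae (Eventually.of_forall fun t ht => ?_)
  rw [Set.uIoc_of_le hx.le] at ht
  exact quotientIntegrand_eq ht.1

theorem continuousAt_quotientIntegrand {μ q γ x : ℝ} (hμ : -1 < μ) (hx : 0 < x) :
    ContinuousAt (quotientIntegrand μ q γ) x := by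
  refine ContinuousAt.mul (ContinuousAt.mul (by fun_prop) ?_) (hasDerivAt_besselI hμ hx).continuousAt
  exact continuousAt_id.rpow_const (Or.inl hx.ne')

theorem hasDerivAt_integral_quotientIntegrand {μ q γ x : ℝ} (hμ : -1 < μ) (hq : -1 < q)
    (hx : 0 < x) :
    HasDerivAt (fun y => ∫ t in (0 : ℝ)..y, quotientIntegrand μ q γ t)
      (quotientIntegrand μ q γ x) x := by
  have hcont : ContinuousOn (quotientIntegrand μ q γ) (Set.Ioi 0) := fun y hy =>
    (continuousAt_quotientIntegrand hμ hy).continuousWithinAt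
  exact intervalIntegral.integral_hasDerivAt_right (intervalIntegrable_quotientIntegrand hμ hq hx)
    (hcont.stronglyMeasurableAtFilter isOpen_Ioi x hx) (continuousAt_quotientIntegrand hμ hx)

/-- The quotient satisfies a linear first-order differential equation. -/
theorem hasDerivAt_sharpQuotient {μ q γ x : ℝ} (hμ : -1 < μ) (hq : -1 < q) (hx : 0 < x) :
    HasDerivAt (sharpQuotient μ q γ)
      (besselI μ x / besselI (μ + 1) x - (-γ + (q - 2 * μ - 1) / x
        + besselI μ x / besselI (μ + 1) x) * sharpQuotient μ q γ x) x := by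
  have hI := (besselI_pos (α := μ + 1) (by linarith) hx).ne'
  have hp := (Real.rpow_pos_of_pos hx (q - μ)).ne'
  have he := (Real.exp_pos (-(γ * x))).ne'
  have hexp : HasDerivAt (fun y : ℝ => Real.exp (-(γ * y))) (Real.exp (-(γ * x)) * -γ) x := by
    have := ((hasDerivAt_id x).const_mul γ).neg.exp
    simpa using this
  have hpow : HasDerivAt (fun y : ℝ => y ^ (q - μ)) ((q - μ) * (x ^ (q - μ) / x)) x := by
    have := Real.hasDerivAt_rpow_const (p := q - μ) (Or.inl hx.ne')
    rwa [Real.rpow_sub_one hx.ne'] at this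
  have hD := (hexp.mul hpow).mul (hasDerivAt_besselI_succ hμ hx)
  refine ((hasDerivAt_integral_quotientIntegrand hμ hq hx).div hD
    (mul_ne_zero (mul_ne_zero he hp) hI)).congr_deriv ?_
  simp only [sharpQuotient, Pi.mul_apply]
  generalize (∫ t in (0 : ℝ)..x, quotientIntegrand μ q γ t) = F
  unfold quotientIntegrand
  field_simp
  ring

/-! ### Expansion of R at infinity. -/

theorem besselI_ratio_inv_sub_isBigO {α : ℝ} (hα : -1 < α) :
    (fun x => besselI α x / besselI (α + 1) x - (1 + (α + 1 / 2) / x))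
      =O[atTop] fun x => 1 / x ^ 2 := by
  have h2 := besselI_ratio_sub_isBigO hα
  have h1 := besselI_ratio_sub_one_isBigO hα
  set h : ℝ → ℝ := fun x => besselI (α + 1) x / besselI α x with hdef
  set c := α + 1 / 2
  have hinv : Tendsto (fun x : ℝ => 1 / x ^ 1) atTop (𝓝 0) := by
    simpa using tendsto_inv_atTop_zero (𝕜 := ℝ)
  have hlim : Tendsto h atTop (𝓝 1) := by
    simpa using (h1.trans_tendsto hinv).add_const 1
  have hlim' : Tendsto (fun x : ℝ => 1 + c / x) atTop (𝓝 1) := by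
    simpa using (tendsto_const_nhds.div_atTop tendsto_id : Tendsto (fun x : ℝ => c / x) atTop (𝓝 0)).const_add 1
  have hb : (fun x => (h x)⁻¹) =O[atTop] fun _ => (1 : ℝ) := (hlim.inv₀ one_ne_zero).isBigO_one ℝ
  -- This is 1 - h(1 + c/x), the numerator of h⁻¹ - (1 + c/x).
  have hnum : (fun x => c ^ 2 * (1 / x ^ 2) - (h x - (1 - c / x)) * (1 + c / x))
      =O[atTop] fun x : ℝ => 1 / x ^ 2 := by
    refine ((isBigO_refl _ _).const_mul_left _).sub ?_
    simpa using h2.mul (hlim'.isBigO_one ℝ)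
  refine IsBigO.congr' (hb.mul hnum) ?_ (by simp)
  filter_upwards [eventually_gt_atTop 0] with x hx
  have p1 := (besselI_pos hα hx).ne'
  have p2 := (besselI_pos (α := α + 1) (by linarith) hx).ne'
  simp only [hdef]
  field_simp
  ring

theorem sharpQuotient_isBigO_atTop {μ q γ : ℝ} (hμ : -1 < μ) (hq : -1 < q) (hγ : γ < 1) :
    (fun x : ℝ => sharpQuotient μ q γ x -
        (1 / (1 - γ) + ((μ + 1 / 2) * (2 - γ) - q) / ((1 - γ) ^ 2 * x)))
      =O[atTop] (fun x : ℝ => 1 / x ^ 2) := by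
  have hg : 0 < 1 - γ := by linarith
  have hε := besselI_ratio_inv_sub_isBigO hμ
  set k : ℝ → ℝ := fun x => besselI μ x / besselI (μ + 1) x with hk
  set r₁ : ℝ := ((μ + 1 / 2) * (2 - γ) - q) / (1 - γ) ^ 2 with hr₁
  have hzero : ∀ c : ℝ, Tendsto (fun x : ℝ => c / x) atTop (𝓝 0) := fun c =>
    tendsto_const_nhds.div_atTop tendsto_id
  have hinv : Tendsto (fun x : ℝ => 1 / x ^ 2) atTop (𝓝 0) :=
    tendsto_const_nhds.div_atTop (tendsto_pow_atTop two_ne_zero)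
  have hklim : Tendsto k atTop (𝓝 1) := by
    have := ((hε.trans_tendsto hinv).add (hzero (μ + 1 / 2))).add_const 1
    simp only [add_zero, zero_add] at this
    exact this.congr fun x => by ring
  have hAlim : Tendsto (fun x => -γ + (q - 2 * μ - 1) / x + k x) atTop (𝓝 (1 - γ)) := by
    have := ((hzero (q - 2 * μ - 1)).const_add (-γ)).add hklim
    rwa [show -γ + 0 + 1 = 1 - γ by ring] at this
  -- The constants 1/(1-γ) and `r₁` cancel the orders 1 and 1/x in the equation; `B` is the
  -- remaining residual.
  refine isBigO_inv_pow_of_hasDerivAt_damped (A := fun x => -γ + (q - 2 * μ - 1) / x + k x)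
    (B := fun x => (k x - (1 + (μ + 1 / 2) / x)) * (1 - 1 / (1 - γ) - r₁ / x)
      + r₁ * (1 - q + (μ + 1 / 2)) * (1 / x ^ 2)) (a := (1 - γ) / 2) 2 (by linarith) ?_
    (hAlim.eventually (le_mem_nhds (by linarith))) ?_
  · filter_upwards [eventually_gt_atTop 0] with x hx
    have hd : HasDerivAt (fun y : ℝ => 1 / (1 - γ) + ((μ + 1 / 2) * (2 - γ) - q) / ((1 - γ) ^ 2 * y))
        (r₁ * (-(x ^ 2)⁻¹)) x := by
      refine (((hasDerivAt_inv hx.ne').const_mul r₁).const_add (1 / (1 - γ))).congr_of_eventuallyEq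
        (Eventually.of_forall fun y => ?_)
      simp only [hr₁, ← div_div]
      ring
    refine ((hasDerivAt_sharpQuotient hμ hq hx).sub hd).congr_deriv ?_
    change k x - (-γ + (q - 2 * μ - 1) / x + k x) * _ - _ = _
    generalize k x = κ
    rw [hr₁]
    field_simp
    ring
  · refine IsBigO.add ?_ ((isBigO_refl _ _).const_mul_left _)
    have hb : Tendsto (fun x : ℝ => 1 - 1 / (1 - γ) - r₁ / x) atTop (𝓝 (1 - 1 / (1 - γ) - 0)) :=
      (hzero r₁).const_sub _
    simpa using hε.mul (hb.isBigO_one ℝ)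

/-! ### Expansion of R at the origin. -/

theorem besselWeight_sub_isBigO {α : ℝ} (hα : -1 < α) (γ : ℝ) :
    (fun t => besselWeight α γ t - besselCoeff α 0 *
        (1 - γ * t + (γ ^ 2 / 2 + 1 / (4 * (α + 1))) * t ^ 2))
      =O[𝓝[>] (0 : ℝ)] fun t => t ^ 3 := by
  have hα' : α + 1 ≠ 0 := by linarith
  have hlim : Tendsto (fun t : ℝ => t ^ 2 / 4) (𝓝[>] 0) (𝓝[≥] 0) := by
    refine tendsto_nhdsWithin_iff.mpr ⟨?_, Eventually.of_forall fun t => by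
      simp only [Set.mem_Ici]; positivity⟩
    have : Continuous fun t : ℝ => t ^ 2 / 4 := by fun_prop
    simpa using (this.tendsto 0).mono_left nhdsWithin_le_nhds
  have hone : ∀ {f : ℝ → ℝ}, Continuous f → f =O[𝓝[>] (0 : ℝ)] fun _ => (1 : ℝ) := fun hf =>
    ((hf.tendsto 0).mono_left nhdsWithin_le_nhds).isBigO_one ℝ
  have hE : (fun t : ℝ => besselEntire α (t ^ 2 / 4)
      - besselCoeff α 0 * (1 + t ^ 2 / 4 / (α + 1))) =O[𝓝[>] (0 : ℝ)] fun t => t ^ 3 := by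
    have h1 := (besselEntire_sub_isBigO hα).comp_tendsto hlim
    have h2 := (isBigO_refl (fun t : ℝ => t ^ 3) (𝓝[>] (0 : ℝ))).mul
      (hone (f := fun t : ℝ => t / 16) (by fun_prop))
    refine h1.trans (h2.congr (fun t => ?_) fun t => mul_one _)
    simp only [Function.comp]
    ring
  have hlin : Tendsto (fun t : ℝ => -(γ * t)) (𝓝[>] 0) (𝓝 0) := by
    have : Continuous fun t : ℝ => -(γ * t) := by fun_prop
    simpa using (this.tendsto 0).mono_left nhdsWithin_le_nhds
  have hexp : (fun t : ℝ => Real.exp (-(γ * t)) - (1 - γ * t + γ ^ 2 / 2 * t ^ 2))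
      =O[𝓝[>] (0 : ℝ)] fun t => t ^ 3 := by
    have h1 := (Real.exp_sub_sum_range_isBigO_pow 3).comp_tendsto hlin
    have h2 := (isBigO_refl (fun t : ℝ => t ^ 3) (𝓝[>] (0 : ℝ))).const_mul_left (-γ ^ 3)
    refine (h1.trans (h2.congr_left fun t => ?_)).congr_left fun t => ?_
    · simp only [Function.comp]
      ring
    · simp only [Function.comp, Finset.sum_range_succ, Finset.sum_range_zero, Nat.factorial]
      push_cast
      ring
  have hE' := (hone (f := fun t : ℝ => Real.exp (-(γ * t))) (by fun_prop)).mul hE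
  have hexp' := hexp.mul
    (hone (f := fun t : ℝ => besselCoeff α 0 * (1 + t ^ 2 / 4 / (α + 1))) (by fun_prop))
  -- The terms of degree at least 3 in the product of the two truncated factors.
  have hrest := (isBigO_refl (fun t : ℝ => t ^ 3) (𝓝[>] (0 : ℝ))).mul
    (hone (f := fun t : ℝ => besselCoeff α 0 * (-γ + γ ^ 2 / 2 * t) / (4 * (α + 1)))
      (by fun_prop))
  simp only [one_mul, mul_one] at hE' hexp' hrest
  refine ((hE'.add hexp').add hrest).congr_left fun t => ?_
  unfold besselWeight
  field_simp
  ring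

/-- Integrating a second-order expansion of `φ` at `0+` against `t^q`. -/
theorem integral_rpow_mul_sub_isBigO {q : ℝ} (hq : -1 < q) {φ : ℝ → ℝ} (hφ : Continuous φ)
    {p₀ p₁ p₂ : ℝ}
    (h : (fun t => φ t - (p₀ + p₁ * t + p₂ * t ^ 2)) =O[𝓝[>] (0 : ℝ)] fun t => t ^ 3) :
    (fun x => (∫ t in (0 : ℝ)..x, t ^ q * φ t) / x ^ (q + 1)
        - (p₀ / (q + 1) + p₁ * x / (q + 2) + p₂ * x ^ 2 / (q + 3)))
      =O[𝓝[>] (0 : ℝ)] fun x => x ^ 3 := by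
  obtain ⟨C, hC⟩ := h.bound
  obtain ⟨δ, hδ, hC⟩ := mem_nhdsGT_iff_exists_Ioo_subset.mp hC
  refine IsBigO.of_bound (C / (q + 4)) ?_
  filter_upwards [Ioo_mem_nhdsGT hδ] with x hx
  have hx0 : 0 < x := hx.1
  have e1 : q + 1 ≠ 0 := by linarith
  have e2 : q + 2 ≠ 0 := by linarith
  have e3 : q + 3 ≠ 0 := by linarith
  have e4 : 0 < q + 4 := by linarith
  have hxp := Real.rpow_pos_of_pos hx0 (q + 1)
  have hmono : ∀ n : ℕ, ∫ t in (0 : ℝ)..x, t ^ (q + n) = x ^ (q + 1) * x ^ n / (q + n + 1) := by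
    intro n
    have hn : (0 : ℝ) ≤ n := n.cast_nonneg
    rw [integral_rpow (Or.inl (by linarith)), Real.zero_rpow (by linarith), sub_zero,
      show q + n + 1 = (q + 1) + n by ring, Real.rpow_add_natCast hx0.ne']
  have hint : ∀ n : ℕ, IntervalIntegrable (fun t : ℝ => t ^ (q + n)) MeasureTheory.volume 0 x :=
    fun n => intervalIntegral.intervalIntegrable_rpow' (by linarith [n.cast_nonneg (α := ℝ)])
  have hpoly : ∫ t in (0 : ℝ)..x, t ^ q * (p₀ + p₁ * t + p₂ * t ^ 2)
      = x ^ (q + 1) * (p₀ / (q + 1) + p₁ * x / (q + 2) + p₂ * x ^ 2 / (q + 3)) := by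
    have : ∫ t in (0 : ℝ)..x, t ^ q * (p₀ + p₁ * t + p₂ * t ^ 2)
        = ∫ t in (0 : ℝ)..x, (p₀ * t ^ (q + (0 : ℕ)) + p₁ * t ^ (q + (1 : ℕ))
          + p₂ * t ^ (q + (2 : ℕ))) := by
      refine intervalIntegral.integral_congr_ae (Eventually.of_forall fun t ht => ?_)
      rw [Set.uIoc_of_le hx0.le] at ht
      simp only [Real.rpow_add_natCast ht.1.ne']
      ring
    rw [this, intervalIntegral.integral_add
        (((hint 0).const_mul _).add ((hint 1).const_mul _)) ((hint 2).const_mul _),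
      intervalIntegral.integral_add ((hint 0).const_mul _) ((hint 1).const_mul _)]
    simp only [intervalIntegral.integral_const_mul, hmono]
    push_cast
    rw [add_zero, show q + 1 + 1 = q + 2 by ring, show q + 2 + 1 = q + 3 by ring]
    ring
  have hdiff : (∫ t in (0 : ℝ)..x, t ^ q * φ t) / x ^ (q + 1)
        - (p₀ / (q + 1) + p₁ * x / (q + 2) + p₂ * x ^ 2 / (q + 3))
      = (∫ t in (0 : ℝ)..x, t ^ q * (φ t - (p₀ + p₁ * t + p₂ * t ^ 2))) / x ^ (q + 1) := by
    simp only [mul_sub]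
    rw [intervalIntegral.integral_sub (intervalIntegrable_rpow_mul_of_continuous hq hφ 0 x)
      (intervalIntegrable_rpow_mul_of_continuous hq (by fun_prop) 0 x), hpoly, sub_div,
      mul_div_cancel_left₀ _ hxp.ne']
  have hbound : ‖∫ t in (0 : ℝ)..x, t ^ q * (φ t - (p₀ + p₁ * t + p₂ * t ^ 2))‖
      ≤ ∫ t in (0 : ℝ)..x, C * t ^ (q + (3 : ℕ)) := by
    refine intervalIntegral.norm_integral_le_of_norm_le hx0.le
      (Eventually.of_forall fun t ht => ?_) ((hint 3).const_mul _)
    have h3 := hC ⟨ht.1, ht.2.trans_lt hx.2⟩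
    have htq := Real.rpow_pos_of_pos ht.1 q
    simp only [Set.mem_ofPred_eq] at h3
    rw [Real.norm_of_nonneg (pow_nonneg ht.1.le 3)] at h3
    rw [norm_mul, Real.norm_of_nonneg htq.le, Real.rpow_add_natCast ht.1.ne']
    calc _ ≤ t ^ q * (C * t ^ 3) := by gcongr
      _ = _ := by ring
  rw [intervalIntegral.integral_const_mul, hmono] at hbound
  rw [hdiff, norm_div, Real.norm_of_nonneg hxp.le, Real.norm_of_nonneg (pow_nonneg hx0.le 3),
    div_le_iff₀ hxp]
  refine hbound.trans_eq ?_
  push_cast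
  rw [show q + 3 + 1 = q + 4 by ring]
  ring

theorem sharpQuotient_eq {μ q γ x : ℝ} (hμ : -1 < μ) (hx : 0 < x) :
    sharpQuotient μ q γ x = 2 * ((∫ t in (0 : ℝ)..x, t ^ q * besselWeight μ γ t) / x ^ (q + 1))
      / besselWeight (μ + 1) γ x := by
  have hE := (besselEntire_pos (α := μ + 1) (by linarith) (z := x ^ 2 / 4) (by positivity)).ne'
  have hp := (Real.rpow_pos_of_pos hx μ).ne'
  have hq := (Real.rpow_pos_of_pos hx q).ne'
  have hh := (Real.rpow_pos_of_pos (show (0 : ℝ) < 1 / 2 by norm_num) μ).ne'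
  rw [sharpQuotient, integral_quotientIntegrand hx, besselI_eq hx, besselWeight,
    Real.rpow_sub hx, div_eq_mul_one_div x 2, Real.mul_rpow hx.le (by norm_num),
    Real.rpow_add_one hx.ne', Real.rpow_add_one hx.ne', Real.rpow_add_one (by norm_num)]
  field_simp

theorem sharpQuotient_isBigO_nhdsGT_zero {μ q : ℝ} (hμ : -1 < μ) (hq : -1 < q) (γ : ℝ) :
    (fun x : ℝ => sharpQuotient μ q γ x -
        2 * (μ + 1) / (q + 1) *
          (1 + γ * x / (q + 2) +
            (γ ^ 2 / ((q + 2) * (q + 3)) + (q + 1) / (4 * (μ + 1) * (q + 3))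
              - 1 / (4 * (μ + 2))) * x ^ 2))
      =O[𝓝[>] (0 : ℝ)] (fun x : ℝ => x ^ 3) := by
  have hμ' : -1 < μ + 1 := by linarith
  have m1 : μ + 1 ≠ 0 := by linarith
  have m2 : μ + 2 ≠ 0 := by linarith
  have e1 : q + 1 ≠ 0 := by linarith
  have e2 : q + 2 ≠ 0 := by linarith
  have e3 : q + 3 ≠ 0 := by linarith
  have hone : ∀ {f : ℝ → ℝ}, Continuous f → f =O[𝓝[>] (0 : ℝ)] fun _ => (1 : ℝ) := fun hf =>
    ((hf.tendsto 0).mono_left nhdsWithin_le_nhds).isBigO_one ℝ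
  set v : ℝ := γ ^ 2 / ((q + 2) * (q + 3)) + (q + 1) / (4 * (μ + 1) * (q + 3))
    - 1 / (4 * (μ + 2)) with hv
  set f₀ : ℝ := besselCoeff (μ + 1) 0 with hf₀
  have hcoeff : besselCoeff μ 0 = (μ + 1) * f₀ := by simpa using besselCoeff_eq_mul hμ 0
  have hD := besselWeight_sub_isBigO hμ' γ
  rw [← hf₀, show μ + 1 + 1 = μ + 2 by ring] at hD
  have hG := integral_rpow_mul_sub_isBigO hq (continuous_besselWeight hμ γ)
    (p₀ := (μ + 1) * f₀) (p₁ := (μ + 1) * f₀ * -γ)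
    (p₂ := (μ + 1) * f₀ * (γ ^ 2 / 2 + 1 / (4 * (μ + 1))))
    ((besselWeight_sub_isBigO hμ γ).congr_left fun t => by rw [hcoeff]; ring)
  have hDP := hD.mul (hone (f := fun x : ℝ => 2 * (μ + 1) / (q + 1) *
    (1 + γ * x / (q + 2) + v * x ^ 2)) (by fun_prop))
  -- With P the claimed quadratic and W the weight, R - P = (2G - W P)/W. The coefficient `v`
  -- cancels degree 2; `hrest` is minus the part of degree at least 3 in the product of P and the
  -- truncation of W.
  have hrest := (isBigO_refl (fun t : ℝ => t ^ 3) (𝓝[>] (0 : ℝ))).mul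
    (hone (f := fun x : ℝ => 2 * (μ + 1) / (q + 1) * f₀ * (γ * v
      - (γ ^ 2 / 2 + 1 / (4 * (μ + 2))) * (γ / (q + 2) + v * x))) (by fun_prop))
  have hinv : (fun x => (besselWeight (μ + 1) γ x)⁻¹) =O[𝓝[>] (0 : ℝ)] fun _ => (1 : ℝ) :=
    hone ((continuous_besselWeight hμ' γ).inv₀ fun x => (besselWeight_pos hμ' γ x).ne')
  have hall := (((hG.const_mul_left 2).sub (hDP.congr_right fun x => mul_one _)).add
    (hrest.congr_right fun x => mul_one _)).mul hinv
  refine IsBigO.congr' hall ?_ (Eventually.of_forall fun x => mul_one _)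
  filter_upwards [self_mem_nhdsWithin] with x hx
  rw [sharpQuotient_eq hμ hx]
  have hw := (besselWeight_pos hμ' γ x).ne'
  generalize (∫ t in (0 : ℝ)..x, t ^ q * besselWeight μ γ t) / x ^ (q + 1) = G
  generalize besselWeight (μ + 1) γ x = W at hw
  rw [← div_eq_mul_inv, div_eq_iff hw, sub_mul (2 * G / W), div_mul_cancel₀ _ hw, hv]
  field_simp
  ring

/-! ### The supremum; the small variable `u` is x at 0 and 1/x at infinity. -/

theorem tendsto_of_sub_isBigO_sq {l : Filter ℝ} {f u : ℝ → ℝ} {c d : ℝ} (hu : Tendsto u l (𝓝 0))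
    (h : (fun x => f x - (c + d * u x)) =O[l] fun x => u x ^ 2) : Tendsto f l (𝓝 c) := by
  have h0 : Tendsto (fun x => u x ^ 2) l (𝓝 0) := by simpa using hu.pow 2
  have := (h.trans_tendsto h0).add ((hu.const_mul d).const_add c)
  simpa using this

theorem eventually_lt_of_sub_isBigO_sq {l : Filter ℝ} {f u : ℝ → ℝ} {c d : ℝ}
    (hu : Tendsto u l (𝓝 0)) (hu0 : ∀ᶠ x in l, 0 < u x) (hd : 0 < d)
    (h : (fun x => f x - (c + d * u x)) =O[l] fun x => u x ^ 2) : ∀ᶠ x in l, c < f x := by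
  have ho : (fun x => u x ^ 2) =o[l] u := by
    have := (isLittleO_pow_id (𝕜 := ℝ) one_lt_two).comp_tendsto hu
    exact this
  filter_upwards [(h.trans_isLittleO ho).bound (half_pos hd), hu0] with x hx h0
  rw [Real.norm_of_nonneg h0.le, Real.norm_eq_abs] at hx
  have := (abs_le.mp hx).1
  have := mul_pos hd h0
  linarith

/-- The limits bound `f` near both ends; compactness bounds it in between. -/
theorem bddAbove_image_Ioi_of_tendsto {f : ℝ → ℝ} {a b c : ℝ} (hf : ContinuousOn f (Set.Ioi a))
    (ha : Tendsto f (𝓝[>] a) (𝓝 b)) (hc : Tendsto f atTop (𝓝 c)) :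
    BddAbove (f '' Set.Ioi a) := by
  obtain ⟨u, hu, hu'⟩ := mem_nhdsGT_iff_exists_Ioo_subset.mp
    (ha.eventually (ge_mem_nhds (lt_add_one b)))
  obtain ⟨v, hv⟩ := eventually_atTop.mp (hc.eventually (ge_mem_nhds (lt_add_one c)))
  obtain ⟨K, hK⟩ := (isCompact_Icc (a := u) (b := v)).bddAbove_image
    (hf.mono fun x hx => lt_of_lt_of_le hu hx.1)
  refine ⟨max (max (b + 1) (c + 1)) K, ?_⟩
  rintro _ ⟨x, hx, rfl⟩
  rcases lt_or_ge x u with h | h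
  · exact (hu' ⟨hx, h⟩ : f x ≤ b + 1).trans ((le_max_left _ _).trans (le_max_left _ _))
  rcases le_or_gt v x with h' | h'
  · exact (hv x h').trans ((le_max_right _ _).trans (le_max_left _ _))
  · exact (hK ⟨x, ⟨h, h'.le⟩, rfl⟩).trans (le_max_right _ _)

theorem mainTheorem8 (μ q γ : ℝ) (hμ : -1 < μ) (hq : -1 < q) (hγ0 : 0 < γ) (hγ1 : γ < 1) :
    -- the integrals in the quotient converge
    (∀ x : ℝ, 0 < x →
      IntervalIntegrable (quotientIntegrand μ q γ) MeasureTheory.volume 0 x) ∧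
    -- expansion as `x ↓ 0`
    (fun x : ℝ => sharpQuotient μ q γ x -
        2 * (μ + 1) / (q + 1) *
          (1 + γ * x / (q + 2) +
            (γ ^ 2 / ((q + 2) * (q + 3)) + (q + 1) / (4 * (μ + 1) * (q + 3))
              - 1 / (4 * (μ + 2))) * x ^ 2))
      =O[𝓝[>] (0 : ℝ)] (fun x : ℝ => x ^ 3) ∧
    -- expansion as `x → ∞`
    (fun x : ℝ => sharpQuotient μ q γ x -
        (1 / (1 - γ) + ((μ + 1 / 2) * (2 - γ) - q) / ((1 - γ) ^ 2 * x)))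
      =O[atTop] (fun x : ℝ => 1 / x ^ 2) ∧
    -- the supremum `M*` is finite, and exceeds the endpoint values
    BddAbove (sharpQuotient μ q γ '' Set.Ioi 0) ∧
    2 * (μ + 1) / (q + 1) < sharpConstant μ q γ ∧
    (q < (μ + 1 / 2) * (2 - γ) → 1 / (1 - γ) < sharpConstant μ q γ) := by
  have hzero := sharpQuotient_isBigO_nhdsGT_zero hμ hq γ
  have htop := sharpQuotient_isBigO_atTop hμ hq hγ1
  have hm : 0 < μ + 1 := by linarith
  have e1 : 0 < q + 1 := by linarith
  have e2 : 0 < q + 2 := by linarith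
  have hg : 0 < 1 - γ := by linarith
  have hu0 : Tendsto (fun x : ℝ => x) (𝓝[>] (0 : ℝ)) (𝓝 0) := nhdsWithin_le_nhds
  have hu1 : Tendsto (fun x : ℝ => 1 / x) atTop (𝓝 0) := tendsto_const_nhds.div_atTop tendsto_id
  have hzero' : (fun x : ℝ => sharpQuotient μ q γ x - (2 * (μ + 1) / (q + 1)
      + 2 * (μ + 1) / (q + 1) * (γ / (q + 2)) * x)) =O[𝓝[>] (0 : ℝ)] fun x => x ^ 2 := by
    have h3 : (fun x : ℝ => x ^ 3) =O[𝓝[>] (0 : ℝ)] fun x : ℝ => x ^ 2 :=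
      ((isLittleO_pow_pow (𝕜 := ℝ) (by norm_num : 2 < 3)).mono nhdsWithin_le_nhds).isBigO
    refine ((hzero.trans h3).add ((isBigO_refl (fun x : ℝ => x ^ 2) (𝓝[>] (0 : ℝ))).const_mul_left
      (2 * (μ + 1) / (q + 1) * (γ ^ 2 / ((q + 2) * (q + 3)) + (q + 1) / (4 * (μ + 1) * (q + 3))
        - 1 / (4 * (μ + 2)))))).congr_left fun x => ?_
    ring
  have htop' : (fun x : ℝ => sharpQuotient μ q γ x - (1 / (1 - γ)
      + ((μ + 1 / 2) * (2 - γ) - q) / (1 - γ) ^ 2 * (1 / x))) =O[atTop] fun x => (1 / x) ^ 2 := by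
    refine htop.congr (fun x => ?_) fun x => by rw [div_pow, one_pow]
    rw [div_mul_div_comm, mul_one]
  have hbdd : BddAbove (sharpQuotient μ q γ '' Set.Ioi 0) :=
    bddAbove_image_Ioi_of_tendsto
      (fun x hx => (hasDerivAt_sharpQuotient hμ hq hx).continuousAt.continuousWithinAt)
      (tendsto_of_sub_isBigO_sq hu0 hzero') (tendsto_of_sub_isBigO_sq hu1 htop')
  -- `sSup` of a real set that is unbounded above is 0, so `hbdd` is indispensable here.
  have hle : ∀ {x : ℝ}, 0 < x → sharpQuotient μ q γ x ≤ sharpConstant μ q γ := fun hx =>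
    le_csSup hbdd (Set.mem_image_of_mem _ hx)
  refine ⟨fun x hx => intervalIntegrable_quotientIntegrand hμ hq hx, hzero, htop, hbdd, ?_, ?_⟩
  -- The slope 2(μ+1)γ/((q+1)(q+2)) is positive because γ > 0.
  · obtain ⟨x, hx, hx0⟩ := ((eventually_lt_of_sub_isBigO_sq hu0 self_mem_nhdsWithin
      (by positivity) hzero').and self_mem_nhdsWithin).exists
    exact hx.trans_le (hle hx0)
  · intro hlt
    have hd : 0 < ((μ + 1 / 2) * (2 - γ) - q) / (1 - γ) ^ 2 :=
      div_pos (by linarith) (by positivity)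
    have hpos : ∀ᶠ x : ℝ in atTop, 0 < 1 / x := by
      filter_upwards [eventually_gt_atTop 0] with x hx using one_div_pos.mpr hx
    obtain ⟨x, hx, hx0⟩ := ((eventually_lt_of_sub_isBigO_sq hu1 hpos hd htop').and
      (eventually_gt_atTop 0)).exists
    exact hx.trans_le (hle hx0)
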